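/- \textbf{Setting.} Let $f:\mathbb R^{n_x}\times\mathbb R^{n_p}\to\mathbb R^{n_x}$, let $P\subset\mathbb R^{n_p}$ be convex and compact, and let $Q$ be the set of $p\in P$ for which $f(z,p)=0$ has a solution $z\in\mathbb R^{n_x}$. Suppose that $Q\neq\emptyset$, that $x:Q\to\mathbb R^{n_x}$ satisfies $f(x(p),p)=0$ for all $p\in Q$, and that $X=[x^{\mathrm L},x^{\mathrm U}]\subset\mathbb R^{n_x}$ is an interval (box) with $x(p)\in X$ for all $p\in Q$. Up to the order of its components let $f=(\tilde f,h)$, where $h:\mathbb R^{n_x}\times\mathbb R^{n_p}\to\mathbb R^{n_h}$ is affine and no component of $\tilde f:\mathbb R^{n_x}\times\mathbb R^{n_p}\to\mathbb R^{n_{\tilde f}}$ is affine. Let $f^{\mathrm{cv}},f^{\mathrm{cc}}:X\times P\to\mathbb R^{n_x}$ be a convex and a concave relaxation of $f$ on $X\times P$ (that is, componentwise, $f^{\mathrm{cv}}$ is convex, $f^{\mathrm{cc}}$ is concave, and $f^{\mathrm{cv}}\le f\le f^{\mathrm{cc}}$), where the components of $h$ are their own relaxations and, on $X\times P$ and for every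 $m\in\{1,\dots,n_{\tilde f}\}$, $$\tilde f_m^{\mathrm{cv}}=\max_{1\le j\le k_m}\tilde f_m^{\mathrm{cv},j},\qquad \tilde f_m^{\mathrm{cc}}=\min_{1\le j\le l_m}\tilde f_m^{\mathrm{cc},j},$$ with continuously differentiable functions $\tilde f_m^{\mathrm{cv},j},\tilde f_m^{\mathrm{cc},j}:\mathbb R^{n_x}\times\mathbb R^{n_p}\to\mathbb R$, the former convex and the latter concave. For $i\in\{1,\dots,n_x\}$ let $$x_i^{\mathrm{cv}}(p):=\inf\{\xi_i:\ \xi\in X,\ f^{\mathrm{cv}}(\xi,p)\le 0\le f^{\mathrm{cc}}(\xi,p)\}\in\mathbb R\cup\{\pm\infty\},\qquad \inf\emptyset:=+\infty .$$ Let $g=(g_c)_{c=1}^{n_g}$ collect all the functions $\tilde f_m^{\mathrm{cv},j}(\xi,p)$, $-\tilde f_m^{\mathrm{cc},j}(\xi,p)$, $x^{\mathrm L}_r-\xi_r$ and $\xi_r-x^{\mathrm U}_r$, so that for $p\in Q$ the value $x_i^{\mathrm{cv}}(p)$ is that of the program $$\min_{\xi\in\mathbb R^{n_x}}\ \xi_i\quad\text{s.t.}\quad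 h(\xi,p)=0,\quad g(\xi,p)\le 0. \tag{1}$$ Let $\hat p\in\mathrm{int}(Q)$. Suppose that the (constant) gradients of $h_1,\dots,h_{n_h}$ with respect to $\xi$ are linearly independent, and that there is a neighborhood $N\subset Q$ of $\hat p$ such that for each $p\in N$ there is a $\xi\in X$ with $h(\xi,p)=0$ and $g(\xi,p)<0$ componentwise. \textbf{Claim.} For every $i\in\{1,\dots,n_x\}$, the function $x_i^{\mathrm{cv}}$ is finite and Lipschitz continuous on a neighborhood of $\hat p$, and it is directionally differentiable at $\hat p$: for each $d\in\mathbb R^{n_p}$ the limit $$[x_i^{\mathrm{cv}}]'(\hat p;d):=\lim_{\alpha\downarrow0}\frac{x_i^{\mathrm{cv}}(\hat p+\alpha d)-x_i^{\mathrm{cv}}(\hat p)}{\alpha}$$ exists and is finite. Moreover, for every optimal solution $\hat\xi$ of (1) with $p=\hat p$ and every $d\in\mathbb R^{n_p}$, writing $\nabla_{\mathbf x}$ and $\nabla_{\mathbf y}$ for the partial gradients with respect to the first and the second argument, $$[x_i^{\mathrm{cv}}]'(\hat p;d)=\min_{w\in\mathbb R^{n_x}} w_i$$ $$\text{s.t.}\quad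 \langle\nabla_{\mathbf x}g_c(\hat\xi,\hat p),w\rangle\le-\langle\nabla_{\mathbf y}g_c(\hat\xi,\hat p),d\rangle\ \text{ for all } c\in\{1,\dots,n_g\} \text{ with } g_c(\hat\xi,\hat p)=0,$$ $$\phantom{\text{s.t.}}\quad \langle\nabla_{\mathbf x}h_j(\hat\xi,\hat p),w\rangle=-\langle\nabla_{\mathbf y}h_j(\hat\xi,\hat p),d\rangle\ \text{ for all } j\in\{1,\dots,n_h\},$$ and the minimum of this linear program is attained. -/

import Mathlib

open Filter Topology
open scoped NNReal

namespace ImplicitRelax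

/-- Euclidean space of dimension `n`. -/
abbrev Vec (n : ℕ) : Type := EuclideanSpace ℝ (Fin n)

/-- The interval `[l, u]` in Euclidean space, for the componentwise order. -/
def box {n : ℕ} (l u : Vec n) : Set (Vec n) :=
  {ξ | ∀ r, l r ≤ ξ r ∧ ξ r ≤ u r}

/-- The set `Q` of the parameters in `P` for which `f (z, p) = 0` has at least one solution `z`. -/
def solvableSet {nx np : ℕ} (f : Vec nx × Vec np → Vec nx) (P : Set (Vec np)) : Set (Vec np) :=
  {p | p ∈ P ∧ ∃ z : Vec nx, f (z, p) = 0}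

/-- `φcv` is a (real-valued, componentwise) convex relaxation of `φ` on `D`. -/
def IsConvexRelaxation {nx np m : ℕ} (φ φcv : Vec nx × Vec np → Vec m)
    (D : Set (Vec nx × Vec np)) : Prop :=
  (∀ z ∈ D, ∀ r, φcv z r ≤ φ z r) ∧ ∀ r, ConvexOn ℝ D (fun z => φcv z r)

/-- `φcc` is a (real-valued, componentwise) concave relaxation of `φ` on `D`. -/
def IsConcaveRelaxation {nx np m : ℕ} (φ φcc : Vec nx × Vec np → Vec m)
    (D : Set (Vec nx × Vec np)) : Prop :=
  (∀ z ∈ D, ∀ r, φ z r ≤ φcc z r) ∧ ∀ r, ConcaveOn ℝ D (fun z => φcc z r)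

/-- The residual system `f (z, p) = 0`, with its parameter set `P`, an implicit function `x` on
the set `Q` of parameters for which the system is solvable, and an interval `X = [xL, xU]`
containing the values of `x`.  Only the values of `x` on `Q` matter. -/
structure ImplicitSystem (nx np : ℕ) where
  f : Vec nx × Vec np → Vec nx
  P : Set (Vec np)
  convex_P : Convex ℝ P
  isCompact_P : IsCompact P
  solvable_nonempty : (solvableSet f P).Nonempty
  x : Vec np → Vec nx
  f_x : ∀ p ∈ solvableSet f P, f (x p, p) = 0
  xL : Vec nx
  xU : Vec nx
  xL_le_xU : ∀ r, xL r ≤ xU r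
  x_mem : ∀ p ∈ solvableSet f P, x p ∈ box xL xU

/-- The set `Q`. -/
def ImplicitSystem.Q {nx np : ℕ} (S : ImplicitSystem nx np) : Set (Vec np) :=
  solvableSet S.f S.P

/-- The interval `X`. -/
def ImplicitSystem.X {nx np : ℕ} (S : ImplicitSystem nx np) : Set (Vec nx) :=
  box S.xL S.xU

/-- An implicit system with convex and concave relaxations `fcv`, `fcc` of the residual function
on `X × P`.  Up to the ordering `e` of the components, `f = (f̃, h)` with `h` affine and no
component of `f̃` affine.  The affine components are their own relaxations, and the relaxations
of the components of `f̃` are maxima of finitely many convex `C¹` functions, respectively minima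
of finitely many concave `C¹` functions. -/
structure RelaxedSystem (nx np nf nh : ℕ) extends ImplicitSystem nx np where
  fcv : Vec nx × Vec np → Vec nx
  fcc : Vec nx × Vec np → Vec nx
  fcv_relax : IsConvexRelaxation f fcv (box xL xU ×ˢ P)
  fcc_relax : IsConcaveRelaxation f fcc (box xL xU ×ˢ P)
  e : Fin nf ⊕ Fin nh ≃ Fin nx
  h : Vec nx × Vec np →ᵃ[ℝ] Vec nh
  f_affine : ∀ z j, f z (e (Sum.inr j)) = h z j
  f_not_affine : ∀ i, ¬ ∃ A : Vec nx × Vec np →ᵃ[ℝ] ℝ, ∀ z, f z (e (Sum.inl i)) = A z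
  fcv_affine : ∀ z ∈ box xL xU ×ˢ P, ∀ j, fcv z (e (Sum.inr j)) = h z j
  fcc_affine : ∀ z ∈ box xL xU ×ˢ P, ∀ j, fcc z (e (Sum.inr j)) = h z j
  k : Fin nf → ℕ
  l : Fin nf → ℕ
  cvPiece : (i : Fin nf) → Fin (k i) → Vec nx × Vec np → ℝ
  ccPiece : (i : Fin nf) → Fin (l i) → Vec nx × Vec np → ℝ
  cvPiece_contDiff : ∀ i j, ContDiff ℝ 1 (cvPiece i j)
  ccPiece_contDiff : ∀ i j, ContDiff ℝ 1 (ccPiece i j)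
  cvPiece_convex : ∀ i j, ConvexOn ℝ Set.univ (cvPiece i j)
  ccPiece_concave : ∀ i j, ConcaveOn ℝ Set.univ (ccPiece i j)
  fcv_eq_max : ∀ z ∈ box xL xU ×ˢ P, ∀ i,
    IsGreatest (Set.range fun j => cvPiece i j z) (fcv z (e (Sum.inl i)))
  fcc_eq_min : ∀ z ∈ box xL xU ×ˢ P, ∀ i,
    IsLeast (Set.range fun j => ccPiece i j z) (fcc z (e (Sum.inl i)))

/-- The indices of the inequality constraints: convex pieces, concave pieces, and the lower and
upper bounds that make up the constraint `ξ ∈ X`. -/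
inductive IneqIdx (nx : ℕ) {nf : ℕ} (k l : Fin nf → ℕ) : Type where
  | cv (i : Fin nf) (j : Fin (k i)) : IneqIdx nx k l
  | cc (i : Fin nf) (j : Fin (l i)) : IneqIdx nx k l
  | lower (r : Fin nx) : IneqIdx nx k l
  | upper (r : Fin nx) : IneqIdx nx k l

/-- The partial gradient with respect to the first variable. -/
noncomputable def gradX {nx np : ℕ} (φ : Vec nx × Vec np → ℝ) (ξ : Vec nx) (p : Vec np) :
    Vec nx :=
  gradient (fun η => φ (η, p)) ξ

/-- The partial gradient with respect to the second variable. -/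
noncomputable def gradY {nx np : ℕ} (φ : Vec nx × Vec np → ℝ) (ξ : Vec nx) (p : Vec np) :
    Vec np :=
  gradient (fun q => φ (ξ, q)) p

namespace RelaxedSystem

variable {nx np nf nh : ℕ}

/-- The component `x_i^cv` of the convex relaxation of the implicit function: the infimum of
`ξ_i` over the `ξ ∈ X` with `f^cv (ξ, p) ≤ 0 ≤ f^cc (ξ, p)`, which is `+∞` if there is none. -/
noncomputable def xcv (S : RelaxedSystem nx np nf nh) (i : Fin nx) (p : Vec np) : EReal :=
  ⨅ ξ ∈ {ξ : Vec nx | ξ ∈ S.X ∧ ∀ r, S.fcv (ξ, p) r ≤ 0 ∧ 0 ≤ S.fcc (ξ, p) r},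
    ((ξ i : ℝ) : EReal)

/-- The inequality constraint functions, in the form `g ≤ 0`. -/
def g (S : RelaxedSystem nx np nf nh) : IneqIdx nx S.k S.l → Vec nx × Vec np → ℝ
  | .cv i j => fun z => S.cvPiece i j z
  | .cc i j => fun z => - S.ccPiece i j z
  | .lower r => fun z => S.xL r - z.1 r
  | .upper r => fun z => z.1 r - S.xU r

/-- The feasible region of the program
`min ξ_i  s.t.  h (ξ, p) = 0,  g (ξ, p) ≤ 0`. -/
def Ω (S : RelaxedSystem nx np nf nh) (p : Vec np) : Set (Vec nx) :=
  {ξ | S.h (ξ, p) = 0 ∧ ∀ c, S.g c (ξ, p) ≤ 0}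

/-- `ξ` is an optimal solution of the program
`min ξ_i  s.t.  h (ξ, p) = 0,  g (ξ, p) ≤ 0`. -/
def IsOptimal (S : RelaxedSystem nx np nf nh) (i : Fin nx) (p : Vec np) (ξ : Vec nx) : Prop :=
  ξ ∈ S.Ω p ∧ ∀ η ∈ S.Ω p, ξ i ≤ η i

/-- The regularity assumption at `p₀`: `p₀` is interior to `Q`, the (constant) gradients of the
components of `h` with respect to `ξ` are linearly independent, and the strong Slater condition
holds at every parameter of some neighbourhood of `p₀` contained in `Q`. -/
structure Regular (S : RelaxedSystem nx np nf nh) (p₀ : Vec np) : Prop where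
  mem_interior : p₀ ∈ interior S.Q
  linearIndependent : ∃ a : Fin nh → Vec nx,
    (∀ j ξ p, gradX (fun z => S.h z j) ξ p = a j) ∧ LinearIndependent ℝ a
  slater : ∃ N ∈ 𝓝 p₀, N ⊆ S.Q ∧
    ∀ p ∈ N, ∃ ξ ∈ S.X, S.h (ξ, p) = 0 ∧ ∀ c, S.g c (ξ, p) < 0

/-- The feasible region, in the variable `w`, of the auxiliary linear program at `(ξ, p)` for the
direction `d`. -/
def auxFeasible (S : RelaxedSystem nx np nf nh) (ξ : Vec nx) (p d : Vec np) : Set (Vec nx) :=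
  {w | (∀ c, S.g c (ξ, p) = 0 →
          inner ℝ (gradX (S.g c) ξ p) w ≤ - inner ℝ (gradY (S.g c) ξ p) d) ∧
       ∀ j, inner ℝ (gradX (fun z => S.h z j) ξ p) w
          = - inner ℝ (gradY (fun z => S.h z j) ξ p) d}

end RelaxedSystem

/-- An extended-real-valued function is locally Lipschitz at `p`: on some neighbourhood of `p`
it is finite and Lipschitz continuous. -/
def LocallyLipschitzAt {n : ℕ} (φ : Vec n → EReal) (p : Vec n) : Prop :=
  ∃ K : ℝ≥0, ∃ N ∈ 𝓝 p, (∀ q ∈ N, φ q ≠ ⊥ ∧ φ q ≠ ⊤) ∧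
    LipschitzOnWith K (fun q => (φ q).toReal) N

/-- An extended-real-valued function, finite near `p`, has the (finite, one-sided) directional
derivative `D` at `p` in the direction `d`. -/
def HasDirDerivAt {n : ℕ} (φ : Vec n → EReal) (D : ℝ) (p d : Vec n) : Prop :=
  (∀ᶠ q in 𝓝 p, φ q ≠ ⊥ ∧ φ q ≠ ⊤) ∧
    Tendsto (fun α : ℝ => ((φ (p + α • d)).toReal - (φ p).toReal) / α) (𝓝[>] 0) (𝓝 D)

/-- Directional differentiability at a point: a finite directional derivative exists in every
direction. -/
def DirDifferentiableAt {n : ℕ} (φ : Vec n → EReal) (p : Vec n) : Prop :=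
  ∀ d, ∃ D : ℝ, HasDirDerivAt φ D p d

end ImplicitRelax

/-! The constraints are jointly convex in `(ξ, p)`, so the optimal value is a convex function of
`p`. It is finite near `p₀`, hence Lipschitz there. For the derivative, difference quotients are
squeezed between values of the linear program at an optimal `ξ₀`. By the gradient inequality, the
quotient `α⁻¹ • (ξ - ξ₀)` of a perturbed solution is feasible for it (`smul_sub_mem_auxFeasible`): a
lower bound. Conversely, a feasible `w`, tilted slightly towards a Slater point, is a direction that
stays feasible for small `α` (`eventually_add_smul_mem_Ω`): an upper bound as the tilt vanishes. The
Lipschitz bound makes the linear program bounded below, so its minimum is attained. -/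

/-! ### Attainment on polyhedra and the gradient inequality. -/

/-- A linear functional that is bounded below on a nonempty polyhedron attains its minimum. -/
theorem exists_isMinOn_polyhedron {V ι : Type*} [AddCommGroup V] [Module ℝ V] [Finite ι]
    (a : ι → V →ₗ[ℝ] ℝ) (b : ι → ℝ) (c : V →ₗ[ℝ] ℝ) (L : ℝ)
    (hne : ∃ w, ∀ i, a i w ≤ b i) (hL : ∀ w, (∀ i, a i w ≤ b i) → L ≤ c w) :
    ∃ w, (∀ i, a i w ≤ b i) ∧ ∀ v, (∀ i, a i v ≤ b i) → c w ≤ c v := by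
  classical
  have := Fintype.ofFinite ι
  -- Without increasing `c`, any feasible point can be moved to one where `c` vanishes on all
  -- directions that fix its active constraints. The induction is on the number of inactive
  -- constraints.
  have face : ∀ n : ℕ, ∀ w, (∀ i, a i w ≤ b i) →
      (Finset.univ.filter fun i => a i w ≠ b i).card = n →
      ∃ w', (∀ i, a i w' ≤ b i) ∧ c w' ≤ c w ∧
        ∀ u, (∀ i, a i w' = b i → a i u = 0) → c u = 0 := by
    intro n
    induction n using Nat.strong_induction_on with
    | _ n ih =>
      intro w hw hn
      by_cases hu : ∀ u, (∀ i, a i w = b i → a i u = 0) → c u = 0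
      · exact ⟨w, hw, le_rfl, hu⟩
      obtain ⟨u, hau, hcu⟩ : ∃ u, (∀ i, a i w = b i → a i u = 0) ∧ c u < 0 := by
        push Not at hu
        obtain ⟨u, h1, h2⟩ := hu
        rcases lt_or_gt_of_ne h2 with h | h
        · exact ⟨u, h1, h⟩
        · exact ⟨-u, fun i hi => by simp [h1 i hi], by simpa using h⟩
      -- Otherwise the ray along `u` stays feasible; the step length below brings `c` down to `L -
      -- 1`.
      have hJ : (Finset.univ.filter fun i => 0 < a i u).Nonempty := by
        by_contra hJ
        have hnon : ∀ i, a i u ≤ 0 := by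
          intro i
          by_contra hi
          exact hJ ⟨i, by simpa using hi⟩
        have ht : 0 ≤ (c w - L + 1) / (-c u) :=
          div_nonneg (by linarith [hL w hw]) (by linarith)
        have hval := hL (w + ((c w - L + 1) / (-c u)) • u) fun i => by
          have := mul_nonpos_of_nonneg_of_nonpos ht (hnon i)
          have := hw i
          simp only [map_add, map_smul, smul_eq_mul]
          linarith
        have hmul : (c w - L + 1) / (-c u) * c u = -(c w - L + 1) := by
          rw [div_neg, neg_mul, div_mul_cancel₀ _ hcu.ne]
        simp only [map_add, map_smul, smul_eq_mul, hmul] at hval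
        linarith
      -- Ratio test: `j` is a first constraint to become active along `u`.
      obtain ⟨j, hj, hmin⟩ :=
        Finset.exists_min_image _ (fun i => (b i - a i w) / a i u) hJ
      simp only [Finset.mem_filter, Finset.mem_univ, true_and] at hj hmin
      set t := (b j - a j w) / a j u with ht_def
      have ht : 0 ≤ t := div_nonneg (by linarith [hw j]) hj.le
      have hfeas : ∀ i, a i (w + t • u) ≤ b i := by
        intro i
        simp only [map_add, map_smul, smul_eq_mul]
        rcases le_or_gt (a i u) 0 with hi | hi
        · have := mul_nonpos_of_nonneg_of_nonpos ht hi
          linarith [hw i]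
        · have := hmin i hi
          rw [le_div_iff₀ hi] at this
          linarith
      have hjact : a j (w + t • u) = b j := by
        simp only [map_add, map_smul, smul_eq_mul, ht_def]
        field_simp
        ring
      have hlt : (Finset.univ.filter fun i => a i (w + t • u) ≠ b i).card < n := by
        rw [← hn]
        apply Finset.card_lt_card
        refine ⟨fun i => ?_, fun hsub => ?_⟩
        · simp only [Finset.mem_filter, Finset.mem_univ, true_and]
          intro h1 h2
          exact h1 (by simp [h2, hau i h2])
        · have : j ∈ Finset.univ.filter fun i => a i w ≠ b i := by
            simp only [Finset.mem_filter, Finset.mem_univ, true_and]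
            intro h
            exact hj.ne' (hau j h)
          have := hsub this
          simp only [Finset.mem_filter, Finset.mem_univ, true_and] at this
          exact this hjact
      obtain ⟨w', h1, h2, h3⟩ := ih _ hlt _ hfeas rfl
      refine ⟨w', h1, h2.trans ?_, h3⟩
      have := mul_nonpos_of_nonneg_of_nonpos ht hcu.le
      simp only [map_add, map_smul, smul_eq_mul]
      linarith
  set G : Set V := {w | (∀ i, a i w ≤ b i) ∧ ∀ u, (∀ i, a i w = b i → a i u = 0) → c u = 0}
    with hG
  set act : V → Set ι := fun w => {i | a i w = b i}
  -- On `G` the value of `c` depends only on the active set: two points sharing it differ by a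
  -- direction on which `c` vanishes.
  have hfin : (c '' G).Finite := by
    refine (Set.finite_range fun s : Set ι =>
      c (Classical.epsilon fun w => w ∈ G ∧ act w = s)).subset ?_
    rintro _ ⟨w, hw, rfl⟩
    refine ⟨act w, ?_⟩
    have hspec := Classical.epsilon_spec (p := fun v => v ∈ G ∧ act v = act w) ⟨w, hw, rfl⟩
    set v := Classical.epsilon fun v => v ∈ G ∧ act v = act w
    have hz := hw.2 (v - w) fun i hi => by
      have h : i ∈ act v := by rw [hspec.2]; exact hi
      have h : a i v = b i := h
      rw [map_sub, h, hi, sub_self]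
    rw [map_sub] at hz
    exact sub_eq_zero.mp hz
  obtain ⟨w₀, hw₀⟩ := hne
  obtain ⟨w₁, h1, -, h3⟩ := face _ w₀ hw₀ rfl
  obtain ⟨_, ⟨w, hw, rfl⟩, hwmin⟩ :=
    Set.exists_min_image (c '' G) id hfin ⟨_, w₁, ⟨h1, h3⟩, rfl⟩
  refine ⟨w, hw.1, fun v hv => ?_⟩
  obtain ⟨v', h1, h2, h3⟩ := face _ v hv rfl
  exact (hwmin _ ⟨v', ⟨h1, h3⟩, rfl⟩).trans h2

/-- The gradient inequality for convex functions. -/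
theorem ConvexOn.fderiv_apply_sub_le {E : Type*} [NormedAddCommGroup E] [NormedSpace ℝ E]
    {φ : E → ℝ} (hφ : ConvexOn ℝ Set.univ φ) {x : E} (hd : DifferentiableAt ℝ φ x) (y : E) :
    fderiv ℝ φ x (y - x) ≤ φ y - φ x := by
  have hconv : ConvexOn ℝ Set.univ (φ ∘ AffineMap.lineMap (k := ℝ) x y) := by
    simpa using hφ.comp_affineMap (AffineMap.lineMap (k := ℝ) x y)
  have hder : HasDerivAt (φ ∘ AffineMap.lineMap (k := ℝ) x y) (fderiv ℝ φ x (y - x)) 0 := by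
    refine HasFDerivAt.comp_hasDerivAt (0 : ℝ) (l := φ) (f := AffineMap.lineMap (k := ℝ) x y) ?_
      AffineMap.hasDerivAt_lineMap
    simpa using hd.hasFDerivAt
  have := hconv.le_slope_of_hasDerivAt (Set.mem_univ 0) (Set.mem_univ 1) zero_lt_one hder
  simpa [slope_def_field] using this

/-! ### Constraint functions and their linearisation. -/

namespace ImplicitRelax

instance {nx nf : ℕ} (k l : Fin nf → ℕ) : Finite (IneqIdx nx k l) := by
  refine Finite.of_injective (β := (Σ i, Fin (k i)) ⊕ (Σ i, Fin (l i)) ⊕ Fin nx ⊕ Fin nx)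
    (fun
      | .cv i j => .inl ⟨i, j⟩
      | .cc i j => .inr (.inl ⟨i, j⟩)
      | .lower r => .inr (.inr (.inl r))
      | .upper r => .inr (.inr (.inr r))) ?_
  rintro (_ | _ | _ | _) (_ | _ | _ | _) h <;> simp_all

theorem inner_gradX {nx np : ℕ} {φ : Vec nx × Vec np → ℝ} {ξ : Vec nx} {p : Vec np}
    (hφ : DifferentiableAt ℝ φ (ξ, p)) (w : Vec nx) :
    inner ℝ (gradX φ ξ p) w = fderiv ℝ φ (ξ, p) (w, 0) := by
  rw [gradX, inner_gradient_left]
  have : HasFDerivAt (fun η => φ (η, p)) _ ξ :=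
    hφ.hasFDerivAt.comp ξ (hasFDerivAt_prodMk_left ξ p)
  simp [this.fderiv]

theorem inner_gradY {nx np : ℕ} {φ : Vec nx × Vec np → ℝ} {ξ : Vec nx} {p : Vec np}
    (hφ : DifferentiableAt ℝ φ (ξ, p)) (d : Vec np) :
    inner ℝ (gradY φ ξ p) d = fderiv ℝ φ (ξ, p) (0, d) := by
  rw [gradY, inner_gradient_left]
  have : HasFDerivAt (fun q => φ (ξ, q)) _ p :=
    hφ.hasFDerivAt.comp p (hasFDerivAt_prodMk_right ξ p)
  simp [this.fderiv]

namespace RelaxedSystem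

variable {nx np nf nh : ℕ} (S : RelaxedSystem nx np nf nh)

theorem contDiff_g (c : IneqIdx nx S.k S.l) : ContDiff ℝ 1 (S.g c) := by
  cases c with
  | cv i j => exact S.cvPiece_contDiff i j
  | cc i j => exact (S.ccPiece_contDiff i j).neg
  | lower r =>
    show ContDiff ℝ 1 fun z : Vec nx × Vec np => S.xL r - z.1 r
    fun_prop
  | upper r =>
    show ContDiff ℝ 1 fun z : Vec nx × Vec np => z.1 r - S.xU r
    fun_prop

theorem convexOn_g (c : IneqIdx nx S.k S.l) : ConvexOn ℝ Set.univ (S.g c) := by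
  cases c with
  | cv i j => exact S.cvPiece_convex i j
  | cc i j => exact (S.ccPiece_concave i j).neg
  | lower r =>
    refine ⟨convex_univ, fun z _ z' _ a b _ _ hab => le_of_eq ?_⟩
    simp only [g, Prod.fst_add, Prod.smul_fst, PiLp.add_apply, PiLp.smul_apply, smul_eq_mul]
    linear_combination -S.xL r * hab
  | upper r =>
    refine ⟨convex_univ, fun z _ z' _ a b _ _ hab => le_of_eq ?_⟩
    simp only [g, Prod.fst_add, Prod.smul_fst, PiLp.add_apply, PiLp.smul_apply, smul_eq_mul]
    linear_combination S.xU r * hab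

theorem differentiableAt_g (c : IneqIdx nx S.k S.l) (z : Vec nx × Vec np) :
    DifferentiableAt ℝ (S.g c) z :=
  (S.contDiff_g c).differentiable one_ne_zero z

theorem hasFDerivAt_h (j : Fin nh) (z : Vec nx × Vec np) :
    HasFDerivAt (fun z => S.h z j)
      ((EuclideanSpace.proj j).comp (LinearMap.toContinuousLinearMap S.h.linear)) z := by
  have : (fun z => S.h z j) = fun z =>
      ((EuclideanSpace.proj j).comp (LinearMap.toContinuousLinearMap S.h.linear)) z
        + S.h 0 j := by
    funext z
    conv_lhs => rw [AffineMap.decomp S.h]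
    simp
  rw [this]
  exact (ContinuousLinearMap.hasFDerivAt _).add_const _

/-- The partial gradients recombine into the joint derivative along `(w, d)`, the form to which
joint convexity applies. -/
theorem mem_auxFeasible {ξ w : Vec nx} {p d : Vec np} :
    w ∈ S.auxFeasible ξ p d ↔
      (∀ c, S.g c (ξ, p) = 0 → fderiv ℝ (S.g c) (ξ, p) (w, d) ≤ 0) ∧
        S.h.linear (w, d) = 0 := by
  have hsplit : ((w, d) : Vec nx × Vec np) = (w, 0) + (0, d) := by simp
  refine and_congr (forall_congr' fun c => imp_congr_right fun _ => ?_) ?_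
  · rw [inner_gradX (S.differentiableAt_g c _), inner_gradY (S.differentiableAt_g c _), hsplit,
      map_add, le_neg_iff_add_nonpos_right]
  · have : S.h.linear (w, d) = 0 ↔ ∀ j, S.h.linear (w, d) j = 0 :=
      ⟨fun h j => by simp [h], fun h => by ext j; simpa using h j⟩
    rw [this]
    refine forall_congr' fun j => ?_
    rw [inner_gradX (S.hasFDerivAt_h j _).differentiableAt,
      inner_gradY (S.hasFDerivAt_h j _).differentiableAt, (S.hasFDerivAt_h j _).fderiv, hsplit,
      map_add, eq_neg_iff_add_eq_zero]
    simp

/-! ### The feasible region. -/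

/-- A maximum is nonpositive iff all its pieces are, and dually for minima; an affine component is
both of its own relaxations, so its two inequalities force equality. -/
theorem mem_Ω_iff {p : Vec np} (hp : p ∈ S.P) {ξ : Vec nx} :
    ξ ∈ S.Ω p ↔ ξ ∈ S.X ∧ ∀ r, S.fcv (ξ, p) r ≤ 0 ∧ 0 ≤ S.fcc (ξ, p) r := by
  constructor
  · rintro ⟨hh, hg⟩
    have hX : ξ ∈ S.X := fun r =>
      ⟨by simpa [g] using hg (.lower r), by simpa [g] using hg (.upper r)⟩
    have hz : (ξ, p) ∈ box S.xL S.xU ×ˢ S.P := ⟨hX, hp⟩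
    refine ⟨hX, fun r => ?_⟩
    obtain ⟨s, rfl⟩ := S.e.surjective r
    cases s with
    | inl m =>
      obtain ⟨j, hj⟩ := (S.fcv_eq_max _ hz m).1
      obtain ⟨j', hj'⟩ := (S.fcc_eq_min _ hz m).1
      simp only at hj hj'
      rw [← hj, ← hj']
      exact ⟨hg (.cv m j), by simpa [g] using hg (.cc m j')⟩
    | inr j => simp [S.fcv_affine _ hz, S.fcc_affine _ hz, hh]
  · rintro ⟨hX, hr⟩
    have hz : (ξ, p) ∈ box S.xL S.xU ×ˢ S.P := ⟨hX, hp⟩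
    refine ⟨?_, fun c => ?_⟩
    · ext j
      have h1 := (hr (S.e (.inr j))).1
      have h2 := (hr (S.e (.inr j))).2
      rw [S.fcv_affine _ hz] at h1
      rw [S.fcc_affine _ hz] at h2
      exact le_antisymm h1 h2
    · cases c with
      | cv m j => exact ((S.fcv_eq_max _ hz m).2 ⟨j, rfl⟩).trans (hr _).1
      | cc m j => exact neg_nonpos.2 ((hr _).2.trans ((S.fcc_eq_min _ hz m).2 ⟨j, rfl⟩))
      | lower r => simpa [g] using (hX r).1
      | upper r => simpa [g] using (hX r).2

theorem xcv_eq_of_isOptimal {i : Fin nx} {p : Vec np} (hp : p ∈ S.P) {ξ : Vec nx}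
    (hξ : S.IsOptimal i p ξ) : S.xcv i p = (ξ i : ℝ) := by
  refine le_antisymm ?_ ?_
  · exact iInf₂_le ξ ((S.mem_Ω_iff hp).1 hξ.1)
  · exact le_iInf₂ fun η hη => EReal.coe_le_coe_iff.2 (hξ.2 η ((S.mem_Ω_iff hp).2 hη))

theorem isCompact_Ω (p : Vec np) : IsCompact (S.Ω p) := by
  have hclosed : IsClosed (S.Ω p) := by
    have hh : Continuous S.h := S.h.continuous_of_finiteDimensional
    have : S.Ω p = {ξ | S.h (ξ, p) = 0} ∩ ⋂ c, {ξ | S.g c (ξ, p) ≤ 0} := by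
      ext; simp [Ω]
    rw [this]
    refine (isClosed_eq (by fun_prop) continuous_const).inter (isClosed_iInter fun c => ?_)
    exact isClosed_le ((S.contDiff_g c).continuous.comp (by fun_prop)) continuous_const
  refine ((isCompact_Icc (a := S.xL.ofLp) (b := S.xU.ofLp)).image
    (PiLp.continuous_toLp 2 fun _ => ℝ)).of_isClosed_subset hclosed fun ξ hξ => ?_
  exact ⟨ξ.ofLp, ⟨fun r => by simpa [g] using hξ.2 (.lower r),
    fun r => by simpa [g] using hξ.2 (.upper r)⟩, rfl⟩

theorem exists_isOptimal (i : Fin nx) {p : Vec np} (hne : (S.Ω p).Nonempty) :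
    ∃ ξ, S.IsOptimal i p ξ := by
  obtain ⟨ξ, hξ, hmin⟩ := (S.isCompact_Ω p).exists_isMinOn hne
    (f := fun ξ => ξ i) (by fun_prop)
  exact ⟨ξ, hξ, fun η hη => hmin hη⟩

/-- Joint convexity of the constraints; this makes the optimal value convex in the parameter. -/
theorem smul_add_smul_mem_Ω {p q : Vec np} {ξ η : Vec nx} (hξ : ξ ∈ S.Ω p) (hη : η ∈ S.Ω q)
    {a b : ℝ} (ha : 0 ≤ a) (hb : 0 ≤ b) (hab : a + b = 1) :
    a • ξ + b • η ∈ S.Ω (a • p + b • q) := by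
  have hz : ((a • ξ + b • η, a • p + b • q) : Vec nx × Vec np) = a • (ξ, p) + b • (η, q) := by
    simp
  refine ⟨?_, fun c => ?_⟩
  · rw [hz, Convex.combo_affine_apply hab, hξ.1, hη.1]
    simp
  · rw [hz]
    refine ((S.convexOn_g c).2 (Set.mem_univ _) (Set.mem_univ _) ha hb hab).trans ?_
    exact add_nonpos (mul_nonpos_of_nonneg_of_nonpos ha (hξ.2 c))
      (mul_nonpos_of_nonneg_of_nonpos hb (hη.2 c))

/-! ### The linear program and feasible perturbations. -/

theorem exists_isMinOn_auxFeasible (ξ : Vec nx) (p d : Vec np) (i : Fin nx) (L : ℝ)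
    (hne : (S.auxFeasible ξ p d).Nonempty) (hL : ∀ w ∈ S.auxFeasible ξ p d, L ≤ w i) :
    ∃ w ∈ S.auxFeasible ξ p d, ∀ v ∈ S.auxFeasible ξ p d, w i ≤ v i := by
  -- Each equality enters as two opposite inequalities.
  let a : {c // S.g c (ξ, p) = 0} ⊕ Fin nh ⊕ Fin nh → Vec nx →ₗ[ℝ] ℝ :=
    Sum.elim (fun c => (innerSL ℝ (gradX (S.g c) ξ p)).toLinearMap)
      (Sum.elim (fun j => (innerSL ℝ (gradX (fun z => S.h z j) ξ p)).toLinearMap)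
        (fun j => -(innerSL ℝ (gradX (fun z => S.h z j) ξ p)).toLinearMap))
  let b : {c // S.g c (ξ, p) = 0} ⊕ Fin nh ⊕ Fin nh → ℝ :=
    Sum.elim (fun c => -inner ℝ (gradY (S.g c) ξ p) d)
      (Sum.elim (fun j => -inner ℝ (gradY (fun z => S.h z j) ξ p) d)
        (fun j => inner ℝ (gradY (fun z => S.h z j) ξ p) d))
  have hmem : ∀ w, w ∈ S.auxFeasible ξ p d ↔ ∀ s, a s w ≤ b s := by
    intro w
    simp only [auxFeasible, Set.mem_ofPred_eq, Sum.forall, Subtype.forall, a, b, Sum.elim_inl,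
      Sum.elim_inr, le_antisymm_iff (α := ℝ), forall_and, LinearMap.neg_apply,
      ContinuousLinearMap.coe_coe, innerSL_apply_apply, neg_le (b := inner ℝ _ d)]
  obtain ⟨w, hw, hmin⟩ := exists_isMinOn_polyhedron a b
    (EuclideanSpace.proj (𝕜 := ℝ) i : Vec nx →L[ℝ] ℝ).toLinearMap L
    (hne.imp fun w => (hmem w).1) fun w hw => hL w ((hmem w).2 hw)
  exact ⟨w, (hmem w).2 hw, fun v hv => hmin v ((hmem v).1 hv)⟩

/-- For an active `c`, the gradient inequality bounds the derivative along the displacement by `g c`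
at its endpoint, which is nonpositive. -/
theorem smul_sub_mem_auxFeasible {ξ η : Vec nx} {p d : Vec np} {α : ℝ} (hα : 0 < α)
    (hξ : ξ ∈ S.Ω p) (hη : η ∈ S.Ω (p + α • d)) :
    α⁻¹ • (η - ξ) ∈ S.auxFeasible ξ p d := by
  have hz : ((α⁻¹ • (η - ξ), d) : Vec nx × Vec np) = α⁻¹ • ((η, p + α • d) - (ξ, p)) := by
    simp [smul_smul, hα.ne']
  rw [mem_auxFeasible, hz]
  refine ⟨fun c hc => ?_, ?_⟩
  · have := (S.convexOn_g c).fderiv_apply_sub_le (S.differentiableAt_g c (ξ, p)) (η, p + α • d)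
    rw [map_smul, smul_eq_mul]
    refine mul_nonpos_of_nonneg_of_nonpos (inv_nonneg.2 hα.le) ?_
    linarith [hη.2 c]
  · rw [map_smul, ← vsub_eq_sub, AffineMap.linearMap_vsub, hξ.1, hη.1]
    simp

/-- Along `w` alone, active constraints have derivative only `≤ 0`. By convexity the direction to
the Slater point has strictly negative derivative, so the tilt by `ε` makes them decrease. Inactive
constraints persist by continuity. -/
theorem eventually_add_smul_mem_Ω {ξ ξs w : Vec nx} {p d : Vec np} (hξ : ξ ∈ S.Ω p)
    (hs : S.h (ξs, p) = 0) (hsg : ∀ c, S.g c (ξs, p) < 0) (hw : w ∈ S.auxFeasible ξ p d)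
    {ε : ℝ} (hε : 0 < ε) :
    ∀ᶠ α in 𝓝[>] (0 : ℝ), ξ + α • (w + ε • (ξs - ξ)) ∈ S.Ω (p + α • d) := by
  rw [mem_auxFeasible] at hw
  set u : Vec nx × Vec np := (w + ε • (ξs - ξ), d) with hu
  have hu' : u = (w, d) + ε • ((ξs, p) - (ξ, p)) := by simp [hu]
  have hz : ∀ α : ℝ, ((ξ + α • (w + ε • (ξs - ξ)), p + α • d) : Vec nx × Vec np)
      = α • u + (ξ, p) := by
    intro α
    simp [hu, add_comm]
  have hlin : S.h.linear u = 0 := by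
    rw [hu', map_add, map_smul, ← vsub_eq_sub, AffineMap.linearMap_vsub, hw.2, hs, hξ.1]
    simp
  have hder : ∀ c, HasDerivAt (fun α : ℝ => S.g c (α • u + (ξ, p)))
      (fderiv ℝ (S.g c) (ξ, p) u) 0 := by
    intro c
    have h1 : HasDerivAt (fun α : ℝ => α • u + (ξ, p)) u 0 := by
      simpa using ((hasDerivAt_id (0 : ℝ)).smul_const u).add_const (ξ, p)
    refine HasFDerivAt.comp_hasDerivAt (0 : ℝ) (l := S.g c) ?_ h1
    simpa using (S.differentiableAt_g c (ξ, p)).hasFDerivAt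
  have hg : ∀ c, ∀ᶠ α in 𝓝[>] (0 : ℝ), S.g c (α • u + (ξ, p)) ≤ 0 := by
    intro c
    rcases (hξ.2 c).lt_or_eq with hc | hc
    · have := (hder c).continuousAt.tendsto.eventually_lt_const (u := 0) (by simpa using hc)
      exact (this.filter_mono nhdsWithin_le_nhds).mono fun _ => le_of_lt
    · have hneg : fderiv ℝ (S.g c) (ξ, p) u < 0 := by
        have h1 := (S.convexOn_g c).fderiv_apply_sub_le (S.differentiableAt_g c (ξ, p)) (ξs, p)
        have h2 : fderiv ℝ (S.g c) (ξ, p) ((ξs, p) - (ξ, p)) < 0 := by linarith [hsg c]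
        rw [hu', map_add, map_smul, smul_eq_mul]
        linarith [hw.1 c hc, mul_neg_of_pos_of_neg hε h2]
      have := ((hasDerivAt_iff_tendsto_slope.1 (hder c)).mono_left
        (nhdsWithin_mono 0 fun x hx => ne_of_gt hx)).eventually_lt_const hneg
      filter_upwards [this, self_mem_nhdsWithin] with α h1 h2
      rw [slope_def_field, div_lt_iff₀ (by simpa using h2)] at h1
      simp only [zero_smul, zero_add, zero_mul, hc, sub_zero] at h1
      exact h1.le
  filter_upwards [eventually_all.2 hg] with α hα
  refine ⟨?_, fun c => by rw [hz]; exact hα c⟩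
  have := S.h.map_vadd (ξ, p) (α • u)
  rw [vadd_eq_add, vadd_eq_add] at this
  rw [hz, this, map_smul, hlin, hξ.1]
  simp

/-! ### Regularity of the optimal value. -/

variable {S}

theorem Regular.exists_ball {p₀ : Vec np} (hS : S.Regular p₀) :
    ∃ r > 0, Metric.ball p₀ r ⊆ S.P ∧ ∀ p ∈ Metric.ball p₀ r, (S.Ω p).Nonempty := by
  obtain ⟨N, hN, hNQ, hsl⟩ := hS.slater
  obtain ⟨r, hr, hrN⟩ := Metric.mem_nhds_iff.1 hN
  refine ⟨r, hr, fun p hp => (hNQ (hrN hp)).1, fun p hp => ?_⟩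
  obtain ⟨ξ, -, hh, hg⟩ := hsl p (hrN hp)
  exact ⟨ξ, hh, fun c => (hg c).le⟩

theorem Regular.eventually_isOptimal {p₀ : Vec np} (hS : S.Regular p₀) (i : Fin nx) :
    ∀ᶠ p in 𝓝 p₀, ∃ ξ, S.IsOptimal i p ξ ∧ S.xcv i p = (ξ i : ℝ) := by
  obtain ⟨r, hr, hP, hΩ⟩ := hS.exists_ball
  filter_upwards [Metric.ball_mem_nhds p₀ hr] with p hp
  obtain ⟨ξ, hξ⟩ := S.exists_isOptimal i (hΩ p hp)
  exact ⟨ξ, hξ, S.xcv_eq_of_isOptimal (hP hp) hξ⟩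

/-- A finite convex function on an open ball in finite dimension is locally Lipschitz. -/
theorem Regular.locallyLipschitzAt_xcv {p₀ : Vec np} (hS : S.Regular p₀) (i : Fin nx) :
    LocallyLipschitzAt (S.xcv i) p₀ := by
  obtain ⟨r, hr, hr'⟩ := Metric.eventually_nhds_iff_ball.1 (hS.eventually_isOptimal i)
  obtain ⟨r', hr0, hP, -⟩ := hS.exists_ball
  set B := Metric.ball p₀ (min r r') with hB
  have hBr : B ⊆ Metric.ball p₀ r := Metric.ball_subset_ball (min_le_left _ _)
  have hBr' : B ⊆ Metric.ball p₀ r' := Metric.ball_subset_ball (min_le_right _ _)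
  have hconv : ConvexOn ℝ B fun q => (S.xcv i q).toReal := by
    refine ⟨convex_ball _ _, fun p hp q hq a b ha hb hab => ?_⟩
    have hpq := convex_ball p₀ (min r r') hp hq ha hb hab
    obtain ⟨ξ, hξ, hξv⟩ := hr' p (hBr hp)
    obtain ⟨η, hη, hηv⟩ := hr' q (hBr hq)
    obtain ⟨ζ, hζ, hζv⟩ := hr' _ (hBr hpq)
    simp only [hξv, hηv, hζv, EReal.toReal_coe, smul_eq_mul]
    simpa using hζ.2 _ (S.smul_add_smul_mem_Ω hξ.1 hη.1 ha hb hab)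
  have hmem : p₀ ∈ B := Metric.mem_ball_self (lt_min hr hr0)
  obtain ⟨K, t, ht, hK⟩ := hconv.locallyLipschitzOn Metric.isOpen_ball hmem
  rw [Metric.isOpen_ball.nhdsWithin_eq hmem] at ht
  refine ⟨K, t ∩ B, inter_mem ht (Metric.isOpen_ball.mem_nhds hmem), fun q hq => ?_,
    hK.mono Set.inter_subset_left⟩
  obtain ⟨ξ, -, hξ⟩ := hr' q (hBr hq.2)
  simp [hξ]

theorem Regular.exists_hasDirDerivAt {p₀ : Vec np} (hS : S.Regular p₀) (i : Fin nx)
    {ξ₀ : Vec nx} (hξ₀ : S.IsOptimal i p₀ ξ₀) (d : Vec np) :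
    ∃ D : ℝ, HasDirDerivAt (S.xcv i) D p₀ d ∧
      IsLeast ((fun w : Vec nx => w i) '' S.auxFeasible ξ₀ p₀ d) D := by
  have hopt := hS.eventually_isOptimal i
  have htend : Tendsto (fun α : ℝ => p₀ + α • d) (𝓝[>] 0) (𝓝 p₀) := by
    have : Continuous fun α : ℝ => p₀ + α • d := by fun_prop
    simpa using (this.tendsto 0).mono_left nhdsWithin_le_nhds
  have hoptα := htend.eventually hopt
  obtain ⟨ξ', hξ', hv₀⟩ := hopt.self_of_nhds
  have hv₀ : (S.xcv i p₀).toReal = ξ₀ i := by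
    rw [hv₀, EReal.toReal_coe]
    exact le_antisymm (hξ'.2 _ hξ₀.1) (hξ₀.2 _ hξ'.1)
  obtain ⟨N, hN, -, hsl⟩ := hS.slater
  obtain ⟨ξs, -, hsh, hsg⟩ := hsl p₀ (mem_of_mem_nhds hN)
  set q : ℝ → ℝ := fun α => ((S.xcv i (p₀ + α • d)).toReal - (S.xcv i p₀).toReal) / α with hq
  have hlow : ∀ᶠ α in 𝓝[>] (0 : ℝ), ∃ w ∈ S.auxFeasible ξ₀ p₀ d, q α = w i := by
    filter_upwards [hoptα, self_mem_nhdsWithin] with α ⟨ξ, hξ, hξv⟩ hα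
    refine ⟨_, S.smul_sub_mem_auxFeasible hα hξ₀.1 hξ.1, ?_⟩
    simp [hq, hξv, hv₀, div_eq_inv_mul]
  have hup : ∀ w ∈ S.auxFeasible ξ₀ p₀ d, ∀ ε > 0, ∀ᶠ α in 𝓝[>] (0 : ℝ),
      q α ≤ w i + ε * (ξs i - ξ₀ i) := by
    intro w hw ε hε
    filter_upwards [hoptα, S.eventually_add_smul_mem_Ω hξ₀.1 hsh hsg hw hε,
      self_mem_nhdsWithin] with α ⟨ξ, hξ, hξv⟩ hmem hα
    have hle := hξ.2 _ hmem
    simp only [PiLp.add_apply, PiLp.smul_apply, PiLp.sub_apply, smul_eq_mul] at hle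
    simp only [hq, hξv, hv₀, EReal.toReal_coe]
    rw [div_le_iff₀ hα]
    linarith
  obtain ⟨K, M, hM, -, hK⟩ := hS.locallyLipschitzAt_xcv i
  have hbd : ∀ᶠ α in 𝓝[>] (0 : ℝ), -(K * ‖d‖) ≤ q α := by
    filter_upwards [htend.eventually hM, self_mem_nhdsWithin] with α hαM hα
    have hα : 0 < α := hα
    have := hK.dist_le_mul _ hαM _ (mem_of_mem_nhds hM)
    rw [Real.dist_eq, dist_eq_norm, add_sub_cancel_left, norm_smul, Real.norm_eq_abs,
      abs_of_pos hα] at this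
    simp only [hq]
    rw [le_div_iff₀ hα]
    linarith [(abs_le.1 this).1]
  have hlim : ∀ w : Vec nx, Tendsto (fun ε : ℝ => w i + ε * (ξs i - ξ₀ i)) (𝓝[>] 0) (𝓝 (w i)) := by
    intro w
    have : Continuous fun ε : ℝ => w i + ε * (ξs i - ξ₀ i) := by fun_prop
    simpa using (this.tendsto 0).mono_left nhdsWithin_le_nhds
  -- For each `ε`, compare the Lipschitz lower bound and the upper bound `hup` at one common `α`;
  -- then let `ε` tend to `0`.
  have hL : ∀ w ∈ S.auxFeasible ξ₀ p₀ d, -(K * ‖d‖) ≤ w i := by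
    intro w hw
    refine ge_of_tendsto (hlim w) ?_
    filter_upwards [self_mem_nhdsWithin] with ε hε
    obtain ⟨α, h1, h2⟩ := (hbd.and (hup w hw ε hε)).exists
    exact h1.trans h2
  obtain ⟨α, w, hw, -⟩ := hlow.exists
  obtain ⟨m, hm, hmin⟩ := S.exists_isMinOn_auxFeasible ξ₀ p₀ d i _ ⟨w, hw⟩ hL
  refine ⟨m i, ⟨hopt.mono fun p ⟨ξ, _, hξ⟩ => by simp [hξ], ?_⟩, ⟨m, hm, rfl⟩, ?_⟩
  -- Every quotient is eventually at least `m i` by `hlow`; for `a > m i`, a small enough tilt of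
  -- `m` keeps the quotients below `a`.
  · refine tendsto_order.2 ⟨fun a ha => ?_, fun a ha => ?_⟩
    · filter_upwards [hlow] with α ⟨w, hw, hqw⟩
      exact ha.trans_le ((hmin w hw).trans_eq hqw.symm)
    · obtain ⟨ε, h1, h2⟩ :=
        (((hlim m).eventually_lt_const ha).and self_mem_nhdsWithin).exists
      exact (hup m hm ε h2).mono fun α h => h.trans_lt h1
  · rintro _ ⟨w, hw, rfl⟩
    exact hmin w hw

end RelaxedSystem

end ImplicitRelax

theorem proposition2 {nx np nf nh : ℕ} (S : ImplicitRelax.RelaxedSystem nx np nf nh)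
    (p₀ : ImplicitRelax.Vec np) (hS : S.Regular p₀) (i : Fin nx) :
    ImplicitRelax.LocallyLipschitzAt (S.xcv i) p₀ ∧
    ImplicitRelax.DirDifferentiableAt (S.xcv i) p₀ ∧
    ∀ ξ₀ : ImplicitRelax.Vec nx, S.IsOptimal i p₀ ξ₀ →
      ∀ d : ImplicitRelax.Vec np, ∃ D : ℝ,
        ImplicitRelax.HasDirDerivAt (S.xcv i) D p₀ d ∧
        IsLeast ((fun w : ImplicitRelax.Vec nx => w i) '' S.auxFeasible ξ₀ p₀ d) D := by
  refine ⟨hS.locallyLipschitzAt_xcv i, fun d => ?_, fun ξ₀ hξ₀ d => hS.exists_hasDirDerivAt i hξ₀ d⟩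
  obtain ⟨ξ₀, hξ₀, -⟩ := (hS.eventually_isOptimal i).self_of_nhds
  obtain ⟨D, hD, -⟩ := hS.exists_hasDirDerivAt i hξ₀ d
  exact ⟨D, hD⟩
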